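/- All graphs are finite and simple, and $L(G)$ denotes the line graph of $G$. For a graph $G$ and a set $S\subseteq V(G)$ with $|S|\ge 2$, a pendant $S$-Steiner tree is a subgraph $T$ of $G$ that is a tree with $S\subseteq V(T)$ in which every vertex of $S$ has degree one. Let $\tau_G(S)$ be the maximum number of pendant $S$-Steiner trees in $G$ that are pairwise internally disjoint, i.e. $E(T)\cap E(T')=\varnothing$ and $V(T)\cap V(T')=S$ for any two of them, and let $\mu_G(S)$ be the maximum number of pairwise edge-disjoint pendant $S$-Steiner trees in $G$. For $k\ge 2$ put $$\tau_k(G)=\min\{\tau_G(S) : S\subseteq V(G),\ |S|=k\},\qquad \mu_k(G)=\min\{\mu_G(S) : S\subseteq V(G),\ |S|=k\},$$ where both are taken to be $0$ if $|V(G)|<k$. **Proposition.** Let $G$ be a connected graph of order $n$ and let $k$ be an integer with $2\le k\le n$. 1. If $\mu_k(G)\ge 1$, then $\tau_k(L(G))\ge \frac{1}{k+1}\log_2\mu_k(G)$. 2. If $\mu_k(G)\ge 1$, then $\mu_k(L(G))\ge \frac{1}{k+1}\log_2\mu_k(G)$. 3. If $\tau_k(G)\ge 2$, then $\tau_k(L(L(G)))\ge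 \frac{1}{k+1}\bigl(1+\log_2(\tau_k(G)-1)\bigr)$. -/

import Mathlib

namespace SimpleGraph

variable {V : Type*}

/-- `T` is a pendant `S`-Steiner tree of `G`: a subgraph of `G` that is a tree, contains all
vertices of `S`, and in which every vertex of `S` has degree one. -/
def IsPendantSteinerTree (G : SimpleGraph V) (S : Finset V) (T : G.Subgraph) : Prop :=
  T.coe.IsTree ∧ (S : Set V) ⊆ T.verts ∧ ∀ v ∈ S, (T.neighborSet v).ncard = 1

/-- Edge-disjoint subgraphs. -/
def EdgeDisjointTrees (G : SimpleGraph V) (T T' : G.Subgraph) : Prop :=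
  T.edgeSet ∩ T'.edgeSet = ∅

/-- Internally disjoint `S`-Steiner trees: no common edge, and no common vertex outside `S`. -/
def InternallyDisjointTrees (G : SimpleGraph V) (S : Finset V) (T T' : G.Subgraph) : Prop :=
  T.edgeSet ∩ T'.edgeSet = ∅ ∧ T.verts ∩ T'.verts = (S : Set V)

/-- `τ_G(S)`: the maximum number of (pairwise) internally disjoint pendant `S`-Steiner trees of a
finite graph `G`. -/
noncomputable def pendantTreeLocalConn (G : SimpleGraph V) (S : Finset V) : ℕ :=
  sSup {l : ℕ | ∃ F : Finset G.Subgraph, F.card = l ∧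
    (∀ T ∈ F, G.IsPendantSteinerTree S T) ∧
    (F : Set G.Subgraph).Pairwise (G.InternallyDisjointTrees S)}

/-- `μ(S)`: the maximum number of (pairwise) edge-disjoint pendant `S`-Steiner trees of a
finite graph `G`. -/
noncomputable def pendantTreeLocalEdgeConn (G : SimpleGraph V) (S : Finset V) : ℕ :=
  sSup {l : ℕ | ∃ F : Finset G.Subgraph, F.card = l ∧
    (∀ T ∈ F, G.IsPendantSteinerTree S T) ∧
    (F : Set G.Subgraph).Pairwise G.EdgeDisjointTrees}

/-- `τ_k(G)`, the pendant-tree `k`-connectivity: the minimum of `τ_G(S)` over all `k`-subsets `S`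
of the vertex set (and `0` if there is no `k`-subset). -/
noncomputable def pendantTreeConn (k : ℕ) (G : SimpleGraph V) : ℕ :=
  sInf {t : ℕ | ∃ S : Finset V, S.card = k ∧ G.pendantTreeLocalConn S = t}

/-- `μ_k(G)`, the pendant-tree `k`-edge-connectivity: the minimum of `μ(S)` over all `k`-subsets
`S` of the vertex set (and `0` if there is no `k`-subset). -/
noncomputable def pendantTreeEdgeConn (k : ℕ) (G : SimpleGraph V) : ℕ :=
  sInf {t : ℕ | ∃ S : Finset V, S.card = k ∧ G.pendantTreeLocalEdgeConn S = t}

end SimpleGraph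

/-!
For `k ≥ 2` and `μ_k(G) ≥ 2` the bound holds without the logarithm: `μ_k(G) ≤ τ_k(L(G))`.

Let `S` be a set of `k` edges of `G`. Choose `k` vertices `X` such that every `e ∈ S` has an end in
`X`, its anchor, all of whose other `S`-edges join it to `X`: adding the edges of `S` one at a time,
each step costs at most one new vertex. In a pendant `X`-tree `T` an edge of `S` is then pendant at
its anchor, so `E(T) \ S` still spans a connected subgraph of `L(G)`, and it is adjacent to every
`e ∈ S`, either at the anchor of `e` or, if `e` itself is the pendant edge there, at the other end.
Hanging `S` on `E(T) \ S` gives a pendant `S`-tree of `L(G)` with vertex set `E(T) ∪ S`, and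
edge-disjoint trees `T` give internally disjoint ones.

The exception is `E(T) ⊆ S`. If two edges of `S` touch, the choice of `X` can start from the two
ends of one of them; then an exceptional `T` is a single edge between the two vertices of `X`, so it
is unique, and it corresponds to the single edge of `L(G)` on `S`.

Applying this to `G` and `L(G)`, with `τ_k ≤ μ_k` in between, bounds `τ_k(L(L(G)))`.
-/

namespace PendantTree

open SimpleGraph

section Extremal

variable {α : Type*}

theorem bddAbove_card [Finite α] (P : Finset α → Prop) :
    BddAbove {l : ℕ | ∃ F : Finset α, F.card = l ∧ P F} := by
  have := Fintype.ofFinite α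
  refine ⟨Fintype.card α, ?_⟩
  rintro _ ⟨F, rfl, -⟩
  exact F.card_le_univ

theorem card_le_sSup_card [Finite α] {P : Finset α → Prop} {F : Finset α} (hF : P F) :
    F.card ≤ sSup {l : ℕ | ∃ F : Finset α, F.card = l ∧ P F} := by
  refine le_csSup (bddAbove_card P) ?_
  exact ⟨F, rfl, hF⟩

theorem exists_card_eq_sSup_card [Finite α] {P : Finset α → Prop} (h : P ∅) :
    ∃ F : Finset α, F.card = sSup {l : ℕ | ∃ F : Finset α, F.card = l ∧ P F} ∧ P F := by
  refine Nat.sSup_mem ?_ (bddAbove_card P)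
  exact ⟨0, ∅, rfl, h⟩

theorem sInf_card_eq_le (f : Finset α → ℕ) (S : Finset α) :
    sInf {t : ℕ | ∃ S' : Finset α, S'.card = S.card ∧ f S' = t} ≤ f S :=
  Nat.sInf_le ⟨S, rfl, rfl⟩

theorem le_sInf_card_eq [Finite α] {f : Finset α → ℕ} {k m : ℕ} (hk : k ≤ Nat.card α)
    (h : ∀ S : Finset α, S.card = k → m ≤ f S) :
    m ≤ sInf {t : ℕ | ∃ S : Finset α, S.card = k ∧ f S = t} := by
  have := Fintype.ofFinite α
  rw [Nat.card_eq_fintype_card] at hk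
  obtain ⟨S, -, hS⟩ := Finset.exists_subset_card_eq (s := Finset.univ) hk
  refine le_csInf ⟨f S, S, hS, rfl⟩ ?_
  rintro _ ⟨S, hS, rfl⟩
  exact h S hS

end Extremal

variable {V : Type*} {G : SimpleGraph V}

section Trees

variable {S : Finset V} {T : G.Subgraph}

theorem mem_of_forall_adj_mem (hT : T.Connected) {W : Set V} (hW : ∀ u w, T.Adj u w → u ∈ W → w ∈ W)
    {a b : V} (ha : a ∈ T.verts) (hb : b ∈ T.verts) (haW : a ∈ W) : b ∈ W := by
  by_contra hbW
  obtain ⟨p⟩ := hT.coe.preconnected ⟨a, ha⟩ ⟨b, hb⟩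
  obtain ⟨d, -, h₁, h₂⟩ := p.exists_boundary_dart {x | (x : V) ∈ W} haW hbW
  exact h₂ (hW _ _ d.adj h₁)

theorem exists_adj_of_ne (hT : T.Connected) {a b : V} (ha : a ∈ T.verts) (hb : b ∈ T.verts)
    (hab : a ≠ b) : ∃ y, T.Adj a y := by
  have : Nontrivial T.verts := ⟨⟨a, ha⟩, ⟨b, hb⟩, fun h => hab (congrArg Subtype.val h)⟩
  obtain ⟨y, hy⟩ := hT.coe.preconnected.exists_adj_of_nontrivial ⟨a, ha⟩
  exact ⟨y, hy⟩

theorem preconnected_coe_deleteVerts_of_subsingleton (hT : T.coe.Preconnected) {R : Set V}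
    (hR : ∀ r ∈ R, (T.neighborSet r).Subsingleton) : (T.deleteVerts R).coe.Preconnected := by
  have hind : (T.coe.induce {v : T.verts | (v : V) ∉ R}).Preconnected :=
    hT.induce_of_degree_eq_one fun v hv a ha b hb =>
      Subtype.ext (hR v (not_not.1 hv) ha hb)
  let φ : T.coe.induce {v : T.verts | (v : V) ∉ R} →g (T.deleteVerts R).coe :=
    { toFun := fun v => ⟨v.1.1, v.1.2, v.2⟩
      map_rel' := fun {a b} h => Subgraph.deleteVerts_adj.2 ⟨a.1.2, a.2, b.1.2, b.2, h⟩ }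
  exact hind.map φ fun v => ⟨⟨⟨v.1, v.2.1⟩, v.2.2⟩, rfl⟩

theorem exists_isPendantSteinerTree_le {K : G.Subgraph} (hK : K.Connected)
    (hS : (S : Set V) ⊆ K.verts) (hleaf : ∀ s ∈ S, (K.neighborSet s).ncard = 1) :
    ∃ T ≤ K, T.verts = K.verts ∧ G.IsPendantSteinerTree S T := by
  obtain ⟨T₀, hle, hT₀⟩ := hK.coe.exists_isTree_le
  let T : G.Subgraph :=
    { verts := K.verts
      Adj := fun x y => ∃ hx hy, T₀.Adj ⟨x, hx⟩ ⟨y, hy⟩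
      adj_sub := fun ⟨_, _, h⟩ => K.adj_sub (hle h)
      edge_vert := fun ⟨hx, _, _⟩ => hx
      symm := ⟨fun _ _ ⟨hx, hy, h⟩ => ⟨hy, hx, h.symm⟩⟩ }
  have hcoe : T.coe = T₀ := by
    ext x y
    exact ⟨fun ⟨_, _, h⟩ => h, fun h => ⟨x.2, y.2, h⟩⟩
  have hTK : T ≤ K := ⟨le_rfl, fun _ _ ⟨_, _, h⟩ => hle h⟩
  have htree : T.coe.IsTree := hcoe ▸ hT₀
  refine ⟨T, hTK, rfl, htree, hS, fun s hs => ?_⟩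
  obtain ⟨y, hy⟩ := Set.ncard_eq_one.1 (hleaf s hs)
  have hsy : K.Adj s y := hy.symm.subset rfl
  obtain ⟨z, hz⟩ := exists_adj_of_ne ⟨htree.connected⟩ (hS hs) hsy.snd_mem hsy.ne
  refine Set.ncard_eq_one.2 ⟨y, Set.Subset.antisymm (fun w hw => hy.subset (hTK.2 hw)) ?_⟩
  obtain rfl : z = y := hy.subset (hTK.2 hz)
  exact Set.singleton_subset_iff.2 hz

/-- The subgraph induced on the core `C` together with one pendant edge from each `s ∈ S` to the
chosen vertex `f s` of `C`. -/
def attachLeaves (C : Set V) (S : Finset V) (f : V → V) (hfC : ∀ s ∈ S, f s ∈ C) :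
    G.Subgraph where
  verts := C ∪ S
  Adj x y := G.Adj x y ∧ ((x ∈ C ∧ y ∈ C) ∨ (x ∈ S ∧ y = f x) ∨ (y ∈ S ∧ x = f y))
  adj_sub h := h.1
  edge_vert := by
    rintro x y ⟨-, ⟨hx, -⟩ | ⟨hx, -⟩ | ⟨hy, rfl⟩⟩
    · exact Or.inl hx
    · exact Or.inr hx
    · exact Or.inl (hfC y hy)
  symm := ⟨by
    rintro x y ⟨hxy, h⟩
    exact ⟨hxy.symm, by tauto⟩⟩

theorem attachLeaves_connected {C : Set V} (hC : (G.induce C).Connected) {f : V → V}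
    (hfC : ∀ s ∈ S, f s ∈ C) (hf : ∀ s ∈ S, G.Adj s (f s)) :
    (attachLeaves (G := G) C S f hfC).Connected := by
  let φ : G.induce C →g (attachLeaves (G := G) C S f hfC).coe :=
    { toFun := fun c => ⟨c, Or.inl c.2⟩
      map_rel' := fun {a b} h => ⟨h, Or.inl ⟨a.2, b.2⟩⟩ }
  have hto_core : ∀ x, ∃ c : C, (attachLeaves (G := G) C S f hfC).coe.Reachable x (φ c) := by
    rintro ⟨x, hx | hx⟩
    · exact ⟨⟨x, hx⟩, .rfl⟩
    · exact ⟨⟨f x, hfC x hx⟩, Adj.reachable ⟨hf x hx, Or.inr (Or.inl ⟨hx, rfl⟩)⟩⟩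
  obtain ⟨c₀⟩ := hC.nonempty
  refine ⟨{ preconnected := fun x y => ?_, nonempty := ⟨⟨c₀, Or.inl c₀.2⟩⟩ }⟩
  obtain ⟨c, hc⟩ := hto_core x
  obtain ⟨d, hd⟩ := hto_core y
  exact (hc.trans ((hC.preconnected c d).map φ)).trans hd.symm

theorem exists_isPendantSteinerTree_of_dominating {C : Set V} (hC : (G.induce C).Connected)
    (hCS : ∀ c ∈ C, c ∉ S) (hdom : ∀ s ∈ S, ∃ c ∈ C, G.Adj s c) :
    ∃ T : G.Subgraph, G.IsPendantSteinerTree S T ∧ T.verts = C ∪ S ∧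
      ∀ x y, T.Adj x y → x ∈ C ∨ y ∈ C := by
  choose! f hfC hf using hdom
  have hleaf : ∀ s ∈ S, ((attachLeaves (G := G) C S f hfC).neighborSet s).ncard = 1 := by
    refine fun s hs => Set.ncard_eq_one.2 ⟨f s, Set.Subset.antisymm ?_ ?_⟩
    · rintro z ⟨-, ⟨h, -⟩ | ⟨-, h⟩ | ⟨h, rfl⟩⟩
      · exact absurd hs (hCS _ h)
      · exact h
      · exact absurd hs (hCS _ (hfC _ h))
    · exact Set.singleton_subset_iff.2 ⟨hf s hs, Or.inr (Or.inl ⟨hs, rfl⟩)⟩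
  obtain ⟨T, hTK, hverts, hT⟩ := exists_isPendantSteinerTree_le
    (attachLeaves_connected hC hfC hf) Set.subset_union_right hleaf
  refine ⟨T, hT, hverts, fun x y hxy => ?_⟩
  obtain ⟨-, ⟨h, -⟩ | ⟨h, rfl⟩ | ⟨h, rfl⟩⟩ := hTK.2 hxy
  · exact Or.inl h
  · exact Or.inr (hfC _ h)
  · exact Or.inl (hfC _ h)

theorem isPendantSteinerTree_subgraphOfAdj [DecidableEq V] {a b : V} (hab : G.Adj a b) :
    G.IsPendantSteinerTree {a, b} (G.subgraphOfAdj hab) := by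
  refine ⟨IsTree.coe_subgraphOfAdj hab, by simp, fun v hv => ?_⟩
  obtain rfl | rfl := Finset.mem_insert.1 hv |>.imp_right Finset.mem_singleton.1
  · rw [neighborSet_fst_subgraphOfAdj, Set.ncard_singleton]
  · rw [neighborSet_snd_subgraphOfAdj, Set.ncard_singleton]

theorem existsUnique_adj (hT : G.IsPendantSteinerTree S T) {s : V} (hs : s ∈ S) :
    ∃! y, T.Adj s y := by
  obtain ⟨y, hy⟩ := Set.ncard_eq_one.1 (hT.2.2 s hs)
  exact ⟨y, hy.symm.subset rfl, fun z hz => hy.subset hz⟩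

theorem verts_subset_pair_of_adj (hT : G.IsPendantSteinerTree S T) {x y : V} (hx : x ∈ S)
    (hy : y ∈ S) (hxy : T.Adj x y) : T.verts ⊆ {x, y} := by
  have hclosed : ∀ u w, T.Adj u w → u ∈ ({x, y} : Set V) → w ∈ ({x, y} : Set V) := by
    obtain ⟨a, -, ha⟩ := existsUnique_adj hT hx
    obtain ⟨b, -, hb⟩ := existsUnique_adj hT hy
    rintro u w huw (rfl | rfl)
    · exact Or.inr ((ha w huw).trans (ha y hxy).symm)
    · exact Or.inl ((hb w huw).trans (hb x hxy.symm).symm)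
  exact fun v hv => mem_of_forall_adj_mem ⟨hT.1.connected⟩ hclosed hxy.fst_mem hv (Or.inl rfl)

theorem edgeSet_eq_singleton_of_adj (hT : G.IsPendantSteinerTree S T) {x y : V} (hx : x ∈ S)
    (hy : y ∈ S) (hxy : T.Adj x y) : T.edgeSet = {s(x, y)} := by
  have hverts := verts_subset_pair_of_adj hT hx hy hxy
  refine Set.Subset.antisymm (fun e he => ?_) (Set.singleton_subset_iff.2 hxy)
  induction e with | _ a b =>
  have hab : T.Adj a b := he
  have hne := hab.ne
  obtain rfl | rfl := hverts hab.fst_mem <;> obtain rfl | rfl := hverts hab.snd_mem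
  · exact absurd rfl hne
  · exact rfl
  · exact Sym2.eq_swap
  · exact absurd rfl hne

theorem eq_pair_of_adj [DecidableEq V] (hT : G.IsPendantSteinerTree S T) {x y : V} (hx : x ∈ S)
    (hy : y ∈ S) (hxy : T.Adj x y) : S = {x, y} := by
  refine Finset.Subset.antisymm (fun s hs => ?_) ?_
  · simpa using verts_subset_pair_of_adj hT hx hy hxy (hT.2.1 hs)
  · simp [Finset.insert_subset_iff, hx, hy]

end Trees

section Connectivities

theorem pendantTreeLocalConn_le_pendantTreeLocalEdgeConn [Finite V] (S : Finset V) :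
    G.pendantTreeLocalConn S ≤ G.pendantTreeLocalEdgeConn S := by
  obtain ⟨F, hcard, htree, hdisj⟩ := exists_card_eq_sSup_card (α := G.Subgraph)
    (P := fun F => (∀ T ∈ F, G.IsPendantSteinerTree S T) ∧
      (F : Set G.Subgraph).Pairwise (G.InternallyDisjointTrees S)) (by simp)
  exact hcard.symm.trans_le <| card_le_sSup_card ⟨htree, hdisj.imp fun _ _ h => h.1⟩

theorem pendantTreeConn_le_pendantTreeEdgeConn [Finite V] {k : ℕ} (hk : k ≤ Nat.card V) :
    G.pendantTreeConn k ≤ G.pendantTreeEdgeConn k :=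
  le_sInf_card_eq hk fun S hS => hS ▸ (sInf_card_eq_le _ S).trans
    (pendantTreeLocalConn_le_pendantTreeLocalEdgeConn S)

theorem exists_edgeDisjoint_family [Finite V] (S : Finset V) :
    ∃ F : Finset G.Subgraph, F.card = G.pendantTreeLocalEdgeConn S ∧
      (∀ T ∈ F, G.IsPendantSteinerTree S T) ∧
      (F : Set G.Subgraph).Pairwise G.EdgeDisjointTrees :=
  exists_card_eq_sSup_card (by simp)

theorem card_le_pendantTreeLocalConn [Finite V] {ι : Type*} {S : Finset V} (hS : S.Nonempty)
    {I : Finset ι} {f : ι → G.Subgraph} (htree : ∀ i ∈ I, G.IsPendantSteinerTree S (f i))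
    (hdisj : (I : Set ι).Pairwise fun i j => G.InternallyDisjointTrees S (f i) (f j)) :
    I.card ≤ G.pendantTreeLocalConn S := by
  classical
  obtain ⟨s, hs⟩ := hS
  have hinj : Set.InjOn f I := by
    intro i hi j hj hij
    by_contra hne
    have hempty : (f i).edgeSet = ∅ := by simpa [← hij] using (hdisj hi hj hne).1
    obtain ⟨y, hy, -⟩ := existsUnique_adj (htree i hi) hs
    exact Set.eq_empty_iff_forall_notMem.1 hempty s(s, y) hy
  rw [← Finset.card_image_of_injOn hinj]
  refine card_le_sSup_card ⟨by simpa using htree, ?_⟩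
  rw [Finset.coe_image]
  rintro _ ⟨i, hi, rfl⟩ _ ⟨j, hj, rfl⟩ hne
  exact hdisj hi hj fun h => hne (congrArg f h)

theorem pendantTreeLocalEdgeConn_le_degree [Finite V] {S : Finset V} {v : V} (hv : v ∈ S)
    [Fintype (G.neighborSet v)] : G.pendantTreeLocalEdgeConn S ≤ G.degree v := by
  obtain ⟨F, hcard, htree, hdisj⟩ := exists_edgeDisjoint_family (G := G) S
  have hadj : ∀ T ∈ F, ∃ y, T.Adj v y := fun T hT =>
    (existsUnique_adj (htree T hT) hv).exists
  have : Nonempty V := ⟨v⟩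
  choose! y hy using hadj
  rw [← hcard, ← card_neighborFinset_eq_degree]
  refine Finset.card_le_card_of_injOn y (fun T hT => by simpa using (hy T hT).adj_sub) ?_
  intro T hT T' hT' h
  by_contra hne
  exact Set.eq_empty_iff_forall_notMem.1 (hdisj hT hT' hne) s(v, y T)
    ⟨hy T hT, h ▸ hy T' hT'⟩

theorem pendantTreeEdgeConn_le_degree [Fintype V] {k : ℕ} (hk : 1 ≤ k)
    (hkV : k ≤ Fintype.card V) (v : V) [Fintype (G.neighborSet v)] :
    G.pendantTreeEdgeConn k ≤ G.degree v := by
  obtain ⟨X, hvX, rfl⟩ := Finset.exists_superset_card_eq (s := {v}) (by simpa using hk) hkV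
  exact (sInf_card_eq_le _ X).trans
    (pendantTreeLocalEdgeConn_le_degree (hvX (Finset.mem_singleton_self v)))

theorem card_le_card_edgeFinset_of_two_le_degree [Fintype V] [DecidableRel G.Adj]
    (hdeg : ∀ v, 2 ≤ G.degree v) : Fintype.card V ≤ G.edgeFinset.card := by
  have hsum : Fintype.card V * 2 ≤ ∑ v, G.degree v := by
    simpa using Finset.card_nsmul_le_sum Finset.univ (fun v => G.degree v) 2 fun v _ => hdeg v
  rw [G.sum_degrees_eq_twice_card_edges] at hsum
  omega

theorem card_le_card_edgeSet_of_two_le_pendantTreeEdgeConn [Finite V] {k : ℕ} (hk : 1 ≤ k)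
    (hkV : k ≤ Nat.card V) (hμ : 2 ≤ G.pendantTreeEdgeConn k) :
    Nat.card V ≤ Nat.card G.edgeSet := by
  classical
  have := Fintype.ofFinite V
  rw [Nat.card_eq_fintype_card] at hkV ⊢
  rw [Nat.card_eq_fintype_card, ← edgeFinset_card]
  exact card_le_card_edgeFinset_of_two_le_degree fun v =>
    hμ.trans (pendantTreeEdgeConn_le_degree hk hkV v)

end Connectivities

section Anchors

variable {X Y : Finset V} {S : Finset G.edgeSet}

/-- Every edge `e ∈ S` has an end `x ∈ X`, its anchor, such that all other edges of `S` at `x` lie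
inside `X`. If `S` is a forest, the set of all its non-root vertices anchors `S`, the anchor of an
edge being its lower end. -/
def Anchors (X : Finset V) (S : Finset G.edgeSet) : Prop :=
  ∀ e ∈ S, ∃ x ∈ X, x ∈ (e : Sym2 V) ∧
    ∀ f ∈ S, x ∈ (f : Sym2 V) → f ≠ e → ∀ y ∈ (f : Sym2 V), y ∈ X

theorem Anchors.mono (h : Anchors X S) (hXY : X ⊆ Y) : Anchors Y S := by
  intro e he
  obtain ⟨x, hx, hxe, hother⟩ := h e he
  exact ⟨x, hXY hx, hxe, fun f hf hxf hne y hy => hXY (hother f hf hxf hne y hy)⟩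

theorem Anchors.insert_edge [DecidableEq V] (h : Anchors X S) (hXY : X ⊆ Y) {e : G.edgeSet}
    {v : V} (hve : v ∈ (e : Sym2 V)) (hvY : v ∈ Y)
    (hother : ∀ f ∈ S, v ∈ (f : Sym2 V) → f ≠ e → ∀ y ∈ (f : Sym2 V), y ∈ Y)
    (hinside : ∀ x ∈ X, x ∈ (e : Sym2 V) → ∀ y ∈ (e : Sym2 V), y ∈ Y) :
    Anchors Y (insert e S) := by
  intro f hf
  obtain rfl | hfS := Finset.mem_insert.1 hf
  · refine ⟨v, hvY, hve, fun g hg hvg hne => ?_⟩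
    exact hother g (Finset.mem_of_mem_insert_of_ne hg hne) hvg hne
  · obtain ⟨x, hx, hxf, hx_other⟩ := h f hfS
    refine ⟨x, hXY hx, hxf, fun g hg hxg hne y hy => ?_⟩
    obtain rfl | hgS := Finset.mem_insert.1 hg
    · exact hinside x hx hxg y hy
    · exact hXY (hx_other g hgS hxg hne y hy)

theorem Anchors.insert_of_notMem [DecidableEq V] (h : Anchors X S) {e : G.edgeSet} {v : V}
    (hve : v ∈ (e : Sym2 V)) (hv : v ∉ X) : Anchors (insert v X) (insert e S) := by
  refine h.insert_edge (Finset.subset_insert v X) hve (Finset.mem_insert_self v X)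
    (fun f hf hvf _ y hy => ?_) (fun x hx hxe y hy => ?_)
  · obtain ⟨x, hx, hxf, -⟩ := h f hf
    have hf_eq := (Sym2.mem_and_mem_iff (ne_of_mem_of_not_mem hx hv)).1 ⟨hxf, hvf⟩
    rw [hf_eq, Sym2.mem_iff] at hy
    obtain rfl | rfl := hy <;> simp [hx]
  · have he_eq := (Sym2.mem_and_mem_iff (ne_of_mem_of_not_mem hx hv)).1 ⟨hxe, hve⟩
    rw [he_eq, Sym2.mem_iff] at hy
    obtain rfl | rfl := hy <;> simp [hx]

theorem Anchors.exists_insert [DecidableEq V] (h : Anchors X S) (e : G.edgeSet) :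
    ∃ v, Anchors (insert v X) (insert e S) := by
  by_cases hinside : ∀ v ∈ (e : Sym2 V), v ∈ X
  swap
  · push Not at hinside
    obtain ⟨v, hve, hv⟩ := hinside
    exact ⟨v, h.insert_of_notMem hve hv⟩
  obtain ⟨v, hve⟩ : ∃ v, v ∈ (e : Sym2 V) := ⟨_, Sym2.out_fst_mem _⟩
  have hanchor : ∀ w, (∀ f ∈ S, v ∈ (f : Sym2 V) → ∀ y ∈ (f : Sym2 V), y ∈ insert w X) →
      Anchors (insert w X) (insert e S) := fun w hw =>
    h.insert_edge (Finset.subset_insert w X) hve (Finset.mem_insert_of_mem (hinside v hve))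
      (fun f hf hvf _ => hw f hf hvf)
      fun _ _ _ y hy => Finset.mem_insert_of_mem (hinside y hy)
  by_cases hout : ∃ g ∈ S, v ∈ (g : Sym2 V) ∧ ∃ w ∈ (g : Sym2 V), w ∉ X
  swap
  · push Not at hout
    exact ⟨v, hanchor v fun f hf hvf y hy => Finset.mem_insert_of_mem (hout f hf hvf y hy)⟩
  -- The anchor of `g` must be `v`, so `w` is the only neighbour of `v` along `S` outside `X`.
  obtain ⟨g, hg, hvg, w, hwg, hw⟩ := hout
  refine ⟨w, hanchor w fun f hf hvf y hy => ?_⟩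
  obtain ⟨x, hx, hxg, hother⟩ := h g hg
  have hg_eq := (Sym2.mem_and_mem_iff (ne_of_mem_of_not_mem (hinside v hve) hw)).1 ⟨hvg, hwg⟩
  have hxv : x = v := by
    rw [hg_eq, Sym2.mem_iff] at hxg
    exact hxg.resolve_right (ne_of_mem_of_not_mem hx hw)
  by_cases hfg : f = g
  · rw [hfg, hg_eq, Sym2.mem_iff] at hy
    obtain hy | hy := hy <;> simp [hy, hinside v hve]
  · exact Finset.mem_insert_of_mem (hother f hf (hxv ▸ hvf) hfg y hy)

theorem Anchors.exists_superset [DecidableEq V] (h : Anchors X S) (R : Finset G.edgeSet) :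
    ∃ Y, X ⊆ Y ∧ Y.card ≤ R.card + X.card ∧ Anchors Y (R ∪ S) := by
  induction R using Finset.induction_on with
  | empty => exact ⟨X, subset_rfl, by simp, by simpa using h⟩
  | insert e R he ih =>
    obtain ⟨Y, hXY, hcard, hY⟩ := ih
    obtain ⟨v, hv⟩ := hY.exists_insert e
    refine ⟨insert v Y, hXY.trans (Finset.subset_insert v Y), ?_, ?_⟩
    · have := Finset.card_insert_le v Y
      rw [Finset.card_insert_of_notMem he]
      omega
    · rwa [Finset.insert_union]

theorem anchors_of_lineGraph_adj [DecidableEq V] {e f : G.edgeSet} (hef : G.lineGraph.Adj e f) :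
    Anchors (e : Sym2 V).toFinset {e, f} := by
  obtain ⟨hne, y, hye, hyf⟩ := lineGraph_adj_iff_exists.1 hef
  obtain ⟨x, hx⟩ := Sym2.mem_iff_exists.1 hye
  have hxe : x ∈ (e : Sym2 V) := hx ▸ Sym2.mem_mk_right y x
  have hyx : y ≠ x := G.ne_of_adj (G.mem_edgeSet.1 (hx ▸ e.2))
  have hxf : x ∉ (f : Sym2 V) := fun hxf =>
    hne (Subtype.ext (hx.trans ((Sym2.mem_and_mem_iff hyx).1 ⟨hyf, hxf⟩).symm))
  intro g hg
  obtain rfl | rfl := Finset.mem_insert.1 hg |>.imp_right Finset.mem_singleton.1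
  · refine ⟨x, Sym2.mem_toFinset.2 hxe, hxe, fun g' hg' hxg' hne' => ?_⟩
    obtain rfl := Finset.mem_singleton.1 (Finset.mem_of_mem_insert_of_ne hg' hne')
    exact absurd hxg' hxf
  · refine ⟨y, Sym2.mem_toFinset.2 hye, hyf, fun g' hg' _ hne' z hz => ?_⟩
    obtain rfl | rfl := Finset.mem_insert.1 hg' |>.imp_right Finset.mem_singleton.1
    · exact Sym2.mem_toFinset.2 hz
    · exact absurd rfl hne'

/-- A vertex set `X` whose pendant trees in `G` can be turned into pendant `S`-trees of the line
graph. The field `inside` excludes the choice of the leaves of a star as `X` when `S` is that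
star. -/
structure IsTerminalSet (X : Finset V) (S : Finset G.edgeSet) : Prop where
  card_eq : X.card = S.card
  anchors : Anchors X S
  inside : ∀ e ∈ S, ∀ f ∈ S, G.lineGraph.Adj e f → ∃ g ∈ S, ∀ v ∈ (g : Sym2 V), v ∈ X

theorem exists_isTerminalSet [Finite V] (hS : S.card ≤ Nat.card V) :
    ∃ X : Finset V, IsTerminalSet X S := by
  classical
  have := Fintype.ofFinite V
  rw [Nat.card_eq_fintype_card] at hS
  by_cases htouch : ∃ e ∈ S, ∃ f ∈ S, G.lineGraph.Adj e f
  · obtain ⟨e, he, f, hf, hef⟩ := htouch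
    obtain ⟨X, heX, hcard, hX⟩ := (anchors_of_lineGraph_adj hef).exists_superset (S \ {e, f})
    have hpair : {e, f} ⊆ S := by simp [Finset.insert_subset_iff, he, hf]
    rw [Finset.sdiff_union_of_subset hpair] at hX
    rw [Sym2.card_toFinset_of_not_isDiag _ (G.not_isDiag_of_mem_edgeSet e.2),
      ← Finset.card_pair hef.ne, Finset.card_sdiff_add_card_eq_card hpair] at hcard
    obtain ⟨Y, hXY, hY⟩ := Finset.exists_superset_card_eq hcard hS
    exact ⟨Y, hY, hX.mono hXY, fun _ _ _ _ _ =>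
      ⟨e, he, fun v hv => hXY (heX (Sym2.mem_toFinset.2 hv))⟩⟩
  · have hempty : Anchors (∅ : Finset V) (∅ : Finset G.edgeSet) := by simp [Anchors]
    obtain ⟨X, -, hcard, hX⟩ := hempty.exists_superset S
    rw [Finset.union_empty] at hX
    obtain ⟨Y, hXY, hY⟩ := Finset.exists_superset_card_eq (by simpa using hcard) hS
    exact ⟨Y, hY, hX.mono hXY, fun e he f hf hef => absurd ⟨e, he, f, hf, hef⟩ htouch⟩

end Anchors

section LineGraph

/-- The edges of a subgraph, as vertices of the line graph of the ambient graph. -/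
def lineVerts (T : G.Subgraph) : Set G.edgeSet := {e | (e : Sym2 V) ∈ T.edgeSet}

theorem reachable_lineVerts_of_mem {T : G.Subgraph} {e f : lineVerts T} {u : V}
    (he : u ∈ (e.1 : Sym2 V)) (hf : u ∈ (f.1 : Sym2 V)) :
    (G.lineGraph.induce (lineVerts T)).Reachable e f := by
  by_cases h : e = f
  · exact h ▸ .rfl
  · have hadj : G.lineGraph.Adj e.1 f.1 :=
      lineGraph_adj_iff_exists.2 ⟨fun h' => h (Subtype.ext h'), u, he, hf⟩
    exact Adj.reachable hadj

theorem preconnected_induce_lineVerts {T : G.Subgraph} (hT : T.coe.Preconnected) :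
    (G.lineGraph.induce (lineVerts T)).Preconnected := by
  have hwalk : ∀ {u w : T.verts} (_ : T.coe.Walk u w) (e f : lineVerts T),
      (u : V) ∈ (e.1 : Sym2 V) → (w : V) ∈ (f.1 : Sym2 V) →
      (G.lineGraph.induce (lineVerts T)).Reachable e f := by
    intro u w p
    induction p with
    | nil => exact fun e f he hf => reachable_lineVerts_of_mem he hf
    | @cons u v w huv _ ih =>
      intro e f he hf
      have hadj : T.Adj u v := huv
      let g : lineVerts T := ⟨⟨s(u, v), hadj.adj_sub⟩, hadj⟩
      exact (reachable_lineVerts_of_mem (f := g) he (Sym2.mem_mk_left _ _)).trans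
        (ih g f (Sym2.mem_mk_right _ _) hf)
  have hend : ∀ e : lineVerts T, ∃ u : T.verts, (u : V) ∈ (e.1 : Sym2 V) := fun e =>
    ⟨⟨_, T.mem_verts_of_mem_edge e.2 (Sym2.out_fst_mem _)⟩, Sym2.out_fst_mem _⟩
  intro e f
  obtain ⟨u, hu⟩ := hend e
  obtain ⟨w, hw⟩ := hend f
  obtain ⟨p⟩ := hT u w
  exact hwalk p e f hu hw

variable {X : Finset V} {S : Finset G.edgeSet} {T T' : G.Subgraph}

theorem exists_adj_terminals_of_lineVerts_subset (hX : IsTerminalSet X S) (hS : 2 ≤ S.card)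
    (hT : G.IsPendantSteinerTree X T) (hsub : lineVerts T ⊆ S) :
    ∃ x ∈ X, ∃ y ∈ X, T.Adj x y := by
  by_contra! hno
  have hS_sub : (S : Set G.edgeSet) ⊆ lineVerts T := by
    intro e he
    obtain ⟨x, hx, -, hother⟩ := hX.anchors e he
    obtain ⟨y, hxy, -⟩ := existsUnique_adj hT hx
    have hmem : (⟨s(x, y), hxy.adj_sub⟩ : G.edgeSet) ∈ lineVerts T := hxy
    by_contra heT
    have hne : (⟨s(x, y), hxy.adj_sub⟩ : G.edgeSet) ≠ e := ne_of_mem_of_not_mem hmem heT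
    exact hno x hx y (hother _ (hsub hmem) (Sym2.mem_mk_left x y) hne y
      (Sym2.mem_mk_right x y)) hxy
  obtain ⟨e, he, f, hf, hef⟩ := Finset.one_lt_card.1 hS
  have hnontrivial : Nontrivial (lineVerts T) :=
    ⟨⟨e, hS_sub he⟩, ⟨f, hS_sub hf⟩, fun h => hef (congrArg Subtype.val h)⟩
  obtain ⟨f', hef'⟩ := (preconnected_induce_lineVerts hT.1.connected.preconnected
    ).exists_adj_of_nontrivial ⟨e, hS_sub he⟩
  obtain ⟨⟨g, hgG⟩, hg, hgX⟩ := hX.inside e he f' (hsub f'.2) hef'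
  induction g with | _ x y =>
  exact hno x (hgX x (Sym2.mem_mk_left x y)) y (hgX y (Sym2.mem_mk_right x y)) (hS_sub hg)

/-- `L` is a pendant `S`-Steiner tree of the line graph on `S` and the edges of `T`, with all its
edges meeting `T` outside `S` except in the degenerate case where `S` contains all of `T`. -/
structure IsLineTree (S : Finset G.edgeSet) (T : G.Subgraph) (L : G.lineGraph.Subgraph) :
    Prop where
  isPendantSteinerTree : G.lineGraph.IsPendantSteinerTree S L
  verts_eq : L.verts = lineVerts T ∪ S
  adj : ∀ e f, L.Adj e f → lineVerts T ⊆ S ∨ e ∈ lineVerts T \ S ∨ f ∈ lineVerts T \ S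

theorem exists_isLineTree_of_subset (hX : IsTerminalSet X S) (hS : 2 ≤ S.card)
    (hT : G.IsPendantSteinerTree X T) (hsub : lineVerts T ⊆ S) : ∃ L, IsLineTree S T L := by
  classical
  obtain ⟨x, hx, y, hy, hxy⟩ := exists_adj_terminals_of_lineVerts_subset hX hS hT hsub
  let e : G.edgeSet := ⟨s(x, y), hxy.adj_sub⟩
  have heS : e ∈ S := hsub (show e ∈ lineVerts T from hxy)
  have hX_eq := eq_pair_of_adj hT hx hy hxy
  have hS_card : S.card = 2 := by rw [← hX.card_eq, hX_eq, Finset.card_pair hxy.ne]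
  obtain ⟨f, hfe⟩ := Finset.card_eq_one.1
    (by rw [Finset.card_erase_of_mem heS, hS_card] : (S.erase e).card = 1)
  have hS_eq : S = {e, f} := by rw [← Finset.insert_erase heS, hfe]
  have hf : f ∈ S.erase e := hfe ▸ Finset.mem_singleton_self f
  obtain ⟨z, hz, hzf, -⟩ := hX.anchors f (Finset.mem_of_mem_erase hf)
  have hze : z ∈ (e : Sym2 V) := by simpa [e, hX_eq] using hz
  have hef : G.lineGraph.Adj e f :=
    lineGraph_adj_iff_exists.2 ⟨(Finset.ne_of_mem_erase hf).symm, z, hze, hzf⟩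
  refine ⟨G.lineGraph.subgraphOfAdj hef, ?_, ?_, fun _ _ _ => Or.inl hsub⟩
  · exact hS_eq ▸ isPendantSteinerTree_subgraphOfAdj hef
  · rw [Set.union_eq_right.2 hsub, hS_eq]
    simp

/-- The terminals incident with an edge of `T` in `S`. In a pendant `X`-tree `T` they are leaves,
and the anchors of the edges of `T` in `S` are among them, so deleting them removes exactly these
edges. -/
def cutLeaves (X : Finset V) (S : Finset G.edgeSet) (T : G.Subgraph) : Set V :=
  {x | x ∈ X ∧ ∃ e ∈ S, x ∈ (e : Sym2 V) ∧ e ∈ lineVerts T}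

theorem lineVerts_deleteVerts_cutLeaves (hX : Anchors X S) (hT : G.IsPendantSteinerTree X T) :
    lineVerts (T.deleteVerts (cutLeaves X S T)) = lineVerts T \ S := by
  have hcut : ∀ {a b} (hab : T.Adj a b), a ∈ cutLeaves X S T →
      (⟨s(a, b), hab.adj_sub⟩ : G.edgeSet) ∈ S := by
    rintro a b hab ⟨ha, e, he, hae, heT⟩
    obtain ⟨c, hc⟩ := Sym2.mem_iff_exists.1 hae
    obtain ⟨y, -, hy⟩ := existsUnique_adj hT ha
    have hac : T.Adj a c := by simpa [lineVerts, hc] using heT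
    obtain rfl : b = c := (hy b hab).trans (hy c hac).symm
    rwa [show (⟨s(a, b), hab.adj_sub⟩ : G.edgeSet) = e from Subtype.ext hc.symm]
  ext ⟨e, he⟩
  induction e with | _ a b =>
  constructor
  · intro h
    obtain ⟨-, ha, -, hb, hab⟩ := Subgraph.deleteVerts_adj.1 h
    refine ⟨hab, fun heS => ?_⟩
    obtain ⟨x, hx, hxe, -⟩ := hX _ heS
    have hx_cut : x ∈ cutLeaves X S T := ⟨hx, _, heS, hxe, hab⟩
    obtain rfl | rfl := Sym2.mem_iff.1 hxe
    · exact ha hx_cut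
    · exact hb hx_cut
  · rintro ⟨h, heS⟩
    have hab : T.Adj a b := h
    refine Subgraph.deleteVerts_adj.2 ⟨hab.fst_mem, fun ha => heS (hcut hab ha), hab.snd_mem,
      fun hb => heS ?_, hab⟩
    rw [Finset.mem_coe, show (⟨s(a, b), he⟩ : G.edgeSet) = ⟨s(b, a), he.symm⟩ from
      Subtype.ext Sym2.eq_swap]
    exact hcut hab.symm hb

theorem deleteVerts_cutLeaves_connected (hX : Anchors X S) (hT : G.IsPendantSteinerTree X T)
    (hsub : ¬ lineVerts T ⊆ S) : (T.deleteVerts (cutLeaves X S T)).Connected := by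
  have hleaf : ∀ x ∈ cutLeaves X S T, (T.neighborSet x).Subsingleton := by
    intro x hx
    obtain ⟨y, hy⟩ := Set.ncard_eq_one.1 (hT.2.2 x hx.1)
    exact hy ▸ Set.subsingleton_singleton
  obtain ⟨⟨e, heG⟩, he⟩ := Set.sdiff_nonempty.2 hsub
  rw [← lineVerts_deleteVerts_cutLeaves hX hT] at he
  induction e with | _ a b =>
  exact ⟨{
    preconnected := preconnected_coe_deleteVerts_of_subsingleton hT.1.connected.preconnected hleaf
    nonempty := ⟨⟨a, Subgraph.edge_vert _ he⟩⟩ }⟩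

theorem induce_lineVerts_sdiff_connected (hX : Anchors X S) (hT : G.IsPendantSteinerTree X T)
    (hsub : ¬ lineVerts T ⊆ S) : (G.lineGraph.induce (lineVerts T \ S)).Connected := by
  have := (Set.sdiff_nonempty.2 hsub).to_subtype
  rw [← lineVerts_deleteVerts_cutLeaves hX hT] at this ⊢
  exact { preconnected := preconnected_induce_lineVerts
            (deleteVerts_cutLeaves_connected hX hT hsub).coe.preconnected }

theorem notMem_of_adj_terminals (hT : G.IsPendantSteinerTree X T)
    (hsub : ¬ lineVerts T ⊆ S) {x y : V} (hx : x ∈ X) (hy : y ∈ X) (hxy : T.Adj x y) :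
    (⟨s(x, y), hxy.adj_sub⟩ : G.edgeSet) ∉ S := by
  refine fun hS => hsub fun e he => ?_
  have he_eq : e = ⟨s(x, y), hxy.adj_sub⟩ :=
    Subtype.ext ((edgeSet_eq_singleton_of_adj hT hx hy hxy).subset he)
  exact he_eq ▸ hS

theorem exists_lineGraph_adj_lineVerts_sdiff (hX : Anchors X S) (hT : G.IsPendantSteinerTree X T)
    (hsub : ¬ lineVerts T ⊆ S) {e : G.edgeSet} (he : e ∈ S) :
    ∃ g ∈ lineVerts T \ S, G.lineGraph.Adj e g := by
  have hadj : ∀ {g : G.edgeSet} {v : V}, g ∈ lineVerts T \ (S : Set G.edgeSet) →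
      v ∈ (e : Sym2 V) → v ∈ (g : Sym2 V) → G.lineGraph.Adj e g := fun hg hve hvg =>
    lineGraph_adj_iff_exists.2 ⟨ne_of_mem_of_not_mem he hg.2, _, hve, hvg⟩
  obtain ⟨x, hx, hxe, hother⟩ := hX e he
  obtain ⟨y, hxy, -⟩ := existsUnique_adj hT hx
  let f : G.edgeSet := ⟨s(x, y), hxy.adj_sub⟩
  by_cases hf : f ∈ S
  swap
  · exact ⟨f, ⟨hxy, hf⟩, hadj ⟨hxy, hf⟩ hxe (Sym2.mem_mk_left x y)⟩
  have hy : y ∉ X := fun hy => notMem_of_adj_terminals hT hsub hx hy hxy hf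
  obtain rfl : f = e := by
    by_contra hfe
    exact hy (hother f hf (Sym2.mem_mk_left x y) hfe y (Sym2.mem_mk_right x y))
  obtain ⟨z, hyz⟩ : ∃ z, (T.deleteVerts (cutLeaves X S T)).Adj y z := by
    have hconn := deleteVerts_cutLeaves_connected hX hT hsub
    have hy_mem : y ∈ (T.deleteVerts (cutLeaves X S T)).verts := ⟨hxy.snd_mem, fun h => hy h.1⟩
    obtain ⟨⟨g, hgG⟩, hg⟩ := Set.sdiff_nonempty.2 hsub
    rw [← lineVerts_deleteVerts_cutLeaves hX hT] at hg
    induction g with | _ a b =>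
    have hab : (T.deleteVerts (cutLeaves X S T)).Adj a b := hg
    by_cases hya : y = a
    · exact ⟨b, hya ▸ hab⟩
    · exact exists_adj_of_ne hconn hy_mem hab.fst_mem hya
  let g : G.edgeSet := ⟨s(y, z), hyz.adj_sub⟩
  have hg : g ∈ lineVerts T \ S := (lineVerts_deleteVerts_cutLeaves hX hT).subset hyz
  exact ⟨g, hg, hadj hg (Sym2.mem_mk_right x y) (Sym2.mem_mk_left y z)⟩

theorem exists_isLineTree (hX : IsTerminalSet X S) (hS : 2 ≤ S.card)
    (hT : G.IsPendantSteinerTree X T) : ∃ L, IsLineTree S T L := by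
  by_cases hsub : lineVerts T ⊆ S
  · exact exists_isLineTree_of_subset hX hS hT hsub
  · obtain ⟨L, hL, hverts, hadj⟩ := exists_isPendantSteinerTree_of_dominating
      (induce_lineVerts_sdiff_connected hX.anchors hT hsub) (fun _ hc => hc.2)
      fun _ he => exists_lineGraph_adj_lineVerts_sdiff hX.anchors hT hsub he
    exact ⟨L, hL, by rw [hverts, Set.sdiff_union_self], fun e f h => Or.inr (hadj e f h)⟩

theorem not_lineVerts_subset_and_of_edgeDisjoint (hX : IsTerminalSet X S) (hS : 2 ≤ S.card)
    (hT : G.IsPendantSteinerTree X T) (hT' : G.IsPendantSteinerTree X T')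
    (hdisj : G.EdgeDisjointTrees T T') : ¬ (lineVerts T ⊆ S ∧ lineVerts T' ⊆ S) := by
  classical
  rintro ⟨hsub, hsub'⟩
  obtain ⟨x, hx, y, hy, hxy⟩ := exists_adj_terminals_of_lineVerts_subset hX hS hT hsub
  obtain ⟨x', hx', y', hy', hxy'⟩ := exists_adj_terminals_of_lineVerts_subset hX hS hT' hsub'
  have hpair : s(x, y) = s(x', y') := by
    have hmem : ∀ z ∈ X, z ∈ s(x, y) := fun z hz => by
      simpa [eq_pair_of_adj hT hx hy hxy] using hz
    exact (Sym2.mem_and_mem_iff hxy'.ne).1 ⟨hmem x' hx', hmem y' hy'⟩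
  exact Set.eq_empty_iff_forall_notMem.1 hdisj s(x, y) ⟨hxy, hpair ▸ hxy'⟩

theorem IsLineTree.internallyDisjointTrees {L L' : G.lineGraph.Subgraph} (hL : IsLineTree S T L)
    (hL' : IsLineTree S T' L') (hdisj : G.EdgeDisjointTrees T T')
    (hsub : ¬ (lineVerts T ⊆ S ∧ lineVerts T' ⊆ S)) :
    G.lineGraph.InternallyDisjointTrees S L L' := by
  have hdisj' : ∀ {e}, e ∈ lineVerts T → e ∉ lineVerts T' := fun he he' =>
    Set.eq_empty_iff_forall_notMem.1 hdisj _ ⟨he, he'⟩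
  have hverts : L.verts ∩ L'.verts = S := by
    rw [hL.verts_eq, hL'.verts_eq, ← Set.inter_union_distrib_right,
      show lineVerts T ∩ lineVerts T' = ∅ from
        Set.eq_empty_iff_forall_notMem.2 fun e he => hdisj' he.1 he.2, Set.empty_union]
  refine ⟨Set.eq_empty_iff_forall_notMem.2 fun ε hε => ?_, hverts⟩
  induction ε with | _ e f =>
  have hef : L.Adj e f := hε.1
  have hef' : L'.Adj e f := hε.2
  have he : e ∈ S := hverts.subset ⟨hef.fst_mem, hef'.fst_mem⟩
  have hf : f ∈ S := hverts.subset ⟨hef.snd_mem, hef'.snd_mem⟩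
  have hcore : ∀ {R : Set G.edgeSet}, ¬ (e ∈ R \ S ∨ f ∈ R \ S) := by
    rintro R (h | h)
    exacts [h.2 he, h.2 hf]
  exact hsub ⟨(hL.adj e f hef).resolve_right hcore, (hL'.adj e f hef').resolve_right hcore⟩

theorem IsTerminalSet.pendantTreeLocalEdgeConn_le [Finite V] (hX : IsTerminalSet X S)
    (hS : 2 ≤ S.card) : G.pendantTreeLocalEdgeConn X ≤ G.lineGraph.pendantTreeLocalConn S := by
  obtain ⟨F, hcard, htree, hdisj⟩ := exists_edgeDisjoint_family (G := G) X
  have hline : ∀ T ∈ F, ∃ L, IsLineTree S T L := fun T hT => exists_isLineTree hX hS (htree T hT)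
  choose! L hL using hline
  rw [← hcard]
  refine card_le_pendantTreeLocalConn (Finset.card_pos.1 (by omega))
    (fun T hT => (hL T hT).isPendantSteinerTree) fun T hT T' hT' hne => ?_
  exact (hL T hT).internallyDisjointTrees (hL T' hT') (hdisj hT hT' hne)
    (not_lineVerts_subset_and_of_edgeDisjoint hX hS (htree T hT) (htree T' hT') (hdisj hT hT' hne))

end LineGraph

section Bounds

variable [Finite V] {k : ℕ}

theorem le_card_edgeSet (hk : 1 ≤ k) (hkV : k ≤ Nat.card V) (hμ : 2 ≤ G.pendantTreeEdgeConn k) :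
    k ≤ Nat.card G.edgeSet :=
  hkV.trans (card_le_card_edgeSet_of_two_le_pendantTreeEdgeConn hk hkV hμ)

theorem pendantTreeEdgeConn_le_pendantTreeConn_lineGraph (hk : 2 ≤ k) (hkV : k ≤ Nat.card V)
    (hμ : 2 ≤ G.pendantTreeEdgeConn k) :
    G.pendantTreeEdgeConn k ≤ G.lineGraph.pendantTreeConn k := by
  refine le_sInf_card_eq (le_card_edgeSet (by omega) hkV hμ) fun S hS => ?_
  obtain ⟨X, hX⟩ := exists_isTerminalSet (hS.trans_le hkV)
  rw [← hS, ← hX.card_eq]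
  exact (sInf_card_eq_le _ X).trans (hX.pendantTreeLocalEdgeConn_le (by omega))

theorem pendantTreeEdgeConn_le_pendantTreeEdgeConn_lineGraph (hk : 2 ≤ k) (hkV : k ≤ Nat.card V)
    (hμ : 2 ≤ G.pendantTreeEdgeConn k) :
    G.pendantTreeEdgeConn k ≤ G.lineGraph.pendantTreeEdgeConn k :=
  (pendantTreeEdgeConn_le_pendantTreeConn_lineGraph hk hkV hμ).trans
    (pendantTreeConn_le_pendantTreeEdgeConn (le_card_edgeSet (by omega) hkV hμ))

theorem pendantTreeConn_le_pendantTreeConn_lineGraph_lineGraph (hk : 2 ≤ k)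
    (hkV : k ≤ Nat.card V) (hτ : 2 ≤ G.pendantTreeConn k) :
    G.pendantTreeConn k ≤ G.lineGraph.lineGraph.pendantTreeConn k := by
  have hτμ := pendantTreeConn_le_pendantTreeEdgeConn (G := G) hkV
  have hμ := hτ.trans hτμ
  have hμL := pendantTreeEdgeConn_le_pendantTreeEdgeConn_lineGraph hk hkV hμ
  exact hτμ.trans <| hμL.trans <| pendantTreeEdgeConn_le_pendantTreeConn_lineGraph hk
    (le_card_edgeSet (by omega) hkV hμ) (hμ.trans hμL)

end Bounds

theorem logb_two_natCast_le (n : ℕ) : Real.logb 2 n ≤ n := by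
  obtain rfl | hn := n.eq_zero_or_pos
  · simp
  · rw [Real.logb_le_iff_le_rpow one_lt_two (by exact_mod_cast hn), Real.rpow_natCast]
    exact_mod_cast Nat.lt_two_pow_self.le

theorem one_add_logb_two_sub_one_le {n : ℕ} (hn : 2 ≤ n) :
    1 + Real.logb 2 ((n : ℝ) - 1) ≤ n := by
  have h := logb_two_natCast_le (n - 1)
  rw [Nat.cast_sub (by omega), Nat.cast_one] at h
  linarith

theorem one_div_succ_mul_le {r : ℝ} {m : ℕ} (h : r ≤ m) (k : ℕ) : 1 / ((k : ℝ) + 1) * r ≤ m := by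
  rw [one_div, inv_mul_le_iff₀ (by positivity)]
  exact h.trans (le_mul_of_one_le_left m.cast_nonneg (by simp))

theorem one_div_succ_mul_logb_two_le {n m : ℕ} (h : 2 ≤ n → n ≤ m) (k : ℕ) :
    1 / ((k : ℝ) + 1) * Real.logb 2 n ≤ m := by
  refine one_div_succ_mul_le ?_ k
  obtain hn | hn := Nat.lt_or_ge n 2
  · interval_cases n <;> simp
  · exact (logb_two_natCast_le n).trans (by exact_mod_cast h hn)

end PendantTree

theorem mainTheorem4 {V : Type*} [Fintype V] (G : SimpleGraph V) (hG : G.Connected)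
    (k : ℕ) (hk : 2 ≤ k) (hkn : k ≤ Fintype.card V) :
    (1 ≤ G.pendantTreeEdgeConn k →
      (1 / ((k : ℝ) + 1)) * Real.logb 2 (G.pendantTreeEdgeConn k : ℝ)
        ≤ (G.lineGraph.pendantTreeConn k : ℝ)) ∧
    (1 ≤ G.pendantTreeEdgeConn k →
      (G.lineGraph.pendantTreeEdgeConn k : ℝ)
        ≥ (1 / ((k : ℝ) + 1)) * Real.logb 2 (G.pendantTreeEdgeConn k : ℝ)) ∧
    (2 ≤ G.pendantTreeConn k →
      (G.lineGraph.lineGraph.pendantTreeConn k : ℝ)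
        ≥ (1 / ((k : ℝ) + 1)) * (1 + Real.logb 2 ((G.pendantTreeConn k : ℝ) - 1))) := by
  have hkV : k ≤ Nat.card V := by rwa [Nat.card_eq_fintype_card]
  refine ⟨fun _ => PendantTree.one_div_succ_mul_logb_two_le ?_ k,
    fun _ => PendantTree.one_div_succ_mul_logb_two_le ?_ k,
    fun hτ => PendantTree.one_div_succ_mul_le ?_ k⟩
  · exact PendantTree.pendantTreeEdgeConn_le_pendantTreeConn_lineGraph hk hkV
  · exact PendantTree.pendantTreeEdgeConn_le_pendantTreeEdgeConn_lineGraph hk hkV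
  · refine (PendantTree.one_add_logb_two_sub_one_le hτ).trans ?_
    exact_mod_cast PendantTree.pendantTreeConn_le_pendantTreeConn_lineGraph_lineGraph hk hkV hτ
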